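/- Let $q=2^r$ be a power of $2$, let $\sigma$ be an automorphism of $\mathbb{F}_q$, and let $R=\mathbb{F}_q[X;\sigma]/(X^2)$ be the truncated skew polynomial ring (with $Xa=\sigma(a)X$ for $a\in\mathbb{F}_q$). Let $\mathrm{PHG}(2,R)$ be the right projective Hjelmslev plane over $R$: its points (resp. lines) are the free rank $1$ (resp. free rank $2$) submodules of the free right module $R^3_R$, and incidence is set inclusion. A $(k,n)$-arc in $\mathrm{PHG}(2,R)$ is a multiset of points of cardinality $k$ such that every line contains at most $n$ of its points, counted with multiplicity; it is projective if no point has multiplicity greater than $1$. Let $\mathrm{m}_n(R)$ denote the largest $k$ for which a projective $(k,n)$-arc in $\mathrm{PHG}(2,R)$ exists. Then there is no $\bigl((q^4-q)/2,\,q^2/2\bigr)$-arc in $\mathrm{PHG}(2,R)$. Moreover, $\mathrm{m}_{q^2/2}(R)<(q^4-q)/2$. -/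

import Mathlib

open scoped MulOpposite

/-! ### Truncated skew polynomial rings -/

/-- The action of the monoid `ℕ` on `F` by the powers of `σ`, for which Mathlib's skew polynomials
satisfy `X * a = σ a * X`. -/
@[reducible] noncomputable def skewAction {F : Type*} [Field F] (σ : F ≃+* F) :
    MulSemiringAction (Multiplicative ℕ) F :=
  MulSemiringAction.compHom F (powersHom (RingAut F) σ)

/-- The ring `F[X; σ] / (X ^ 2)`: the quotient of the skew polynomial ring by the two-sided
ideal generated by `X ^ 2`. -/
def TruncSkewPoly (F : Type*) [Field F] (σ : F ≃+* F) : Type _ :=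
  letI := skewAction σ
  (TwoSidedIdeal.span {(SkewPolynomial.X : SkewPolynomial F) ^ 2}).ringCon.Quotient

noncomputable instance (F : Type*) [Field F] (σ : F ≃+* F) : Ring (TruncSkewPoly F σ) :=
  letI := skewAction σ
  inferInstanceAs
    (Ring (TwoSidedIdeal.span {(SkewPolynomial.X : SkewPolynomial F) ^ 2}).ringCon.Quotient)

/-! ### The right projective Hjelmslev plane -/

namespace PHG

/-- The submodules of the free right module `R³` which are free of rank `d`. Right modules over `R`
are modules over the opposite ring; the right scalar action on `Fin 3 → R` is coordinatewise right
multiplication. -/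
def FreeSub (R : Type*) [Ring R] (d : ℕ) : Type _ :=
  {U : Submodule Rᵐᵒᵖ (Fin 3 → R) // Nonempty (Module.Basis (Fin d) Rᵐᵒᵖ U)}

/-- The points: free submodules of rank 1. -/
abbrev Point (R : Type*) [Ring R] : Type _ := FreeSub R 1

/-- The lines: free submodules of rank 2. -/
abbrev Line (R : Type*) [Ring R] : Type _ := FreeSub R 2

variable {R : Type*} [Ring R]

/-- Incidence is set inclusion. -/
def Incident (P : Point R) (L : Line R) : Prop := P.1 ≤ L.1

open scoped Classical in
/-- The multiplicity `𝔎(L)`: the number of points of the multiset on `L`, counted with their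
multiplicities. -/
noncomputable def lineMult (K : Multiset (Point R)) (L : Line R) : ℕ :=
  K.countP (fun P => Incident P L)

/-- A `(k, n)`-arc: a multiset of points of cardinality `k` such that every line has multiplicity
at most `n`. -/
def IsArc (K : Multiset (Point R)) (k n : ℕ) : Prop :=
  K.card = k ∧ ∀ L : Line R, lineMult K L ≤ n

/-- An arc is projective if every point has multiplicity 0 or 1. -/
def IsProjectiveArc (K : Multiset (Point R)) (k n : ℕ) : Prop :=
  IsArc K k n ∧ K.Nodup

/-- `m` is the number `m_n(R)`: the largest size of a projective arc with all line multiplicities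
at most `n`. -/
def IsMaxArcSize (R : Type*) [Ring R] (n m : ℕ) : Prop :=
  IsGreatest {k : ℕ | ∃ K : Multiset (Point R), IsProjectiveArc K k n} m

end PHG

/-! ### Arcs in finite Hjelmslev planes of even order -/

section HjelmslevCounting

open Finset
open scoped Classical

variable {P L C τ : Type*} [Fintype P] [Fintype L]

/-! Write `q = 2m`, `k = (q^4-q)/2`, `n = q^2/2`. Summing the line multiplicities through a point of
the arc bounds its neighbour class by `q(q-1)/2`. There are `q^2+q+1` classes and `k` is exactly
`q^2+q+1` times this bound, so every estimate is tight: the arc is projective, each line has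
multiplicity `0` or `n`, and the number of `0`-lines through a point is `0` on the arc and `2` off
it. The total number of `0`-lines is odd.

The points with coordinates in `F` contradict this. The line `u + w ε` contains the point of `x ∈
F³` iff `u ⬝ᵥ x = 0` and `σ⁻¹(w) ⬝ᵥ x = 0`, and for even `q` this system has an odd number of
nonzero solutions (`odd_card_ne_zero_orthogonal`). Incidences between these vectors and the
`0`-lines are therefore even in number when counted by vectors, odd when counted by lines
(`no_maximal_arc_of_odd_transversal`).

The ring enters only through its form `F ⊕ F ε` (`TruncSkewPoly.twistedDual`), which reduces the
incidence numbers to linear algebra over `F`; `TwistedDual.not_isArc` assembles the pieces. -/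

/-- In a finite incidence structure with the counting parameters of a projective Hjelmslev plane,
the total multiplicity of the lines through a point. -/
theorem sum_lineMult_through {I : P → L → Prop} {c : P → C} {q : ℕ}
    (h1 : ∀ p, #{l | I p l} = q ^ 2 + q)
    (h2 : ∀ p p', p ≠ p' → c p = c p' → #{l | I p l ∧ I p' l} = q)
    (h3 : ∀ p p', c p ≠ c p' → #{l | I p l ∧ I p' l} = 1) (κ : P → ℕ) (p : P) :
    ((∑ l with I p l, ∑ p' with I p' l, κ p' : ℕ) : ℤ) =
      ∑ p', (κ p' : ℤ) + (q - 1) * ∑ p' with c p' = c p, (κ p' : ℤ) + q ^ 2 * κ p := by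
  have e1 : ∑ l with I p l, ∑ p' with I p' l, κ p' =
      ∑ p', #{l | I p l ∧ I p' l} * κ p' := by
    simp only [sum_filter, card_filter, sum_mul]
    rw [sum_comm (s := univ (α := P))]
    refine sum_congr rfl (fun l _ => ?_)
    by_cases h : I p l <;> simp [h]
  -- The intersection numbers `1`, `q`, `q^2 + q` are split as `1`, plus `q - 1` for neighbours,
  -- plus `q^2` for equality.
  have e2 : ∀ p', ((#{l | I p l ∧ I p' l} * κ p' : ℕ) : ℤ) =
      κ p' + (q - 1) * (if c p' = c p then (κ p' : ℤ) else 0) +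
        q ^ 2 * (if p' = p then (κ p' : ℤ) else 0) := by
    intro p'
    by_cases hp : p' = p
    · subst hp
      have : #{l | I p' l ∧ I p' l} = q ^ 2 + q := by simpa only [and_self] using h1 p'
      rw [this]
      push_cast
      simp
      ring
    · by_cases hc : c p' = c p
      · rw [h2 p p' (Ne.symm hp) hc.symm]
        push_cast
        simp [hp, hc]
        ring
      · rw [h3 p p' (Ne.symm hc)]
        simp [hp, hc]
  rw [e1, Nat.cast_sum, sum_congr rfl (fun p' _ => e2 p'), sum_add_distrib, sum_add_distrib,
    ← mul_sum, ← mul_sum, ← sum_filter]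
  simp

/-- A finite incidence structure with the counting parameters of a projective Hjelmslev plane of
even order `q = 2 * m`, in which some family of points meets every line an odd number of times, has
no multiset of `(q ^ 4 - q) / 2` points with all line multiplicities at most `q ^ 2 / 2`. -/
theorem no_maximal_arc_of_odd_transversal [Fintype C] [Fintype τ] {I : P → L → Prop}
    {c : P → C} (t : τ → P) {m : ℕ} (hm : 0 < m)
    (h1 : ∀ p, #{l | I p l} = (2 * m) ^ 2 + 2 * m)
    (h2 : ∀ p p', p ≠ p' → c p = c p' → #{l | I p l ∧ I p' l} = 2 * m)
    (h3 : ∀ p p', c p ≠ c p' → #{l | I p l ∧ I p' l} = 1)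
    (hL : Even (Fintype.card L)) (hC : Fintype.card C = (2 * m) ^ 2 + 2 * m + 1)
    (hT : ∀ l, Odd #{x | I (t x) l}) (κ : P → ℕ) (hk : (∑ p, κ p : ℕ) = (8 * m ^ 4 - m : ℤ))
    (hκ : ∀ l, ∑ p with I p l, κ p ≤ 2 * m ^ 2) : False := by
  set M : L → ℕ := fun l => ∑ p with I p l, κ p with hM
  set U : C → ℕ := fun x => ∑ p with c p = x, κ p with hU
  have hmz : (0 : ℤ) < m := by exact_mod_cast hm
  have hS : ∀ p, ((∑ l with I p l, M l : ℕ) : ℤ) =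
      (8 * m ^ 4 - m) + (2 * m - 1) * U (c p) + (2 * m) ^ 2 * κ p := by
    intro p
    have h := sum_lineMult_through h1 h2 h3 κ p
    rw [h, ← hk, hU]
    push_cast
    ring
  have hSle : ∀ p, ((∑ l with I p l, M l : ℕ) : ℤ) ≤ ((2 * m) ^ 2 + 2 * m) * (2 * m ^ 2) := by
    intro p
    have : ∑ l with I p l, M l ≤ #{l | I p l} * (2 * m ^ 2) := by
      rw [← smul_eq_mul]
      exact sum_le_card_nsmul _ _ _ (fun l _ => hκ l)
    rw [h1] at this
    exact_mod_cast this
  have hUle : ∀ x, (U x : ℤ) ≤ m * (2 * m - 1) := by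
    intro x
    by_cases hx : ∃ p, c p = x ∧ κ p ≠ 0
    · obtain ⟨p, rfl, hp⟩ := hx
      have h := hSle p
      rw [hS] at h
      have hp' : (1 : ℤ) ≤ κ p := by exact_mod_cast Nat.one_le_iff_ne_zero.2 hp
      have : (2 * m - 1 : ℤ) * U (c p) ≤ (2 * m - 1) * (m * (2 * m - 1)) := by
        nlinarith [mul_le_mul_of_nonneg_left hp' (sq_nonneg (2 * m : ℤ))]
      exact le_of_mul_le_mul_left this (by linarith)
    · push Not at hx
      have : U x = 0 := sum_eq_zero (fun p hp => hx p (by simpa using hp))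
      rw [this]
      push_cast
      nlinarith
  -- The class bounds add up to exactly the size of the arc, so none of them is strict.
  have hUeq : ∀ x, (U x : ℤ) = m * (2 * m - 1) := by
    have hsum : ∑ x, (U x : ℤ) = ∑ _x : C, (m * (2 * m - 1) : ℤ) := by
      have : ∑ x, U x = ∑ p, κ p := sum_fiberwise _ _ _
      rw [sum_const, card_univ, hC, ← Nat.cast_sum, this, hk]
      simp only [nsmul_eq_mul]
      push_cast
      ring
    intro x
    exact (sum_eq_sum_iff_of_le (fun x _ => hUle x)).1 hsum x (mem_univ x)
  have hκ1 : ∀ p, κ p ≠ 0 → κ p = 1 := by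
    intro p hp
    have h := hSle p
    rw [hS, hUeq] at h
    have hp' : (1 : ℤ) ≤ κ p := by exact_mod_cast Nat.one_le_iff_ne_zero.2 hp
    have h' : (m : ℤ) ^ 2 * κ p ≤ m ^ 2 * 1 := by nlinarith
    have := le_of_mul_le_mul_left h' (by positivity)
    have : (κ p : ℤ) = 1 := le_antisymm this hp'
    exact_mod_cast this
  -- Through a point of the arc the multiplicities sum to `q^2 + q` times their maximum, so each
  -- attains it.
  have hMfull : ∀ p l, κ p ≠ 0 → I p l → M l = 2 * m ^ 2 := by
    intro p l hp hl
    have h : ∑ l with I p l, M l = ∑ l with I p l, 2 * m ^ 2 := by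
      rw [sum_const, h1]
      zify
      rw [← Nat.cast_sum, hS, hUeq, hκ1 p hp]
      simp only [nsmul_eq_mul]
      push_cast
      ring
    exact (sum_eq_sum_iff_of_le (fun l _ => hκ l)).1 h l (by simpa using hl)
  have hM2 : ∀ l, M l = if M l = 0 then 0 else 2 * m ^ 2 := by
    intro l
    split_ifs with h
    · exact h
    · obtain ⟨p, hp, hp0⟩ := exists_ne_zero_of_sum_ne_zero h
      exact hMfull p l hp0 (by simpa using hp)
  have hm2 : (2 * m ^ 2 : ℤ) ≠ 0 := by positivity
  -- The multiplicities through `p` sum to `n(q^2 + q)` if `p` is on the arc and to `n(q^2 + q - 2)`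
  -- otherwise, which leaves `0` or `2` lines of multiplicity zero.
  have hEven : ∀ p, Even #{l | I p l ∧ M l = 0} := by
    intro p
    have hsplit : #{l | I p l ∧ M l = 0} + #{l | I p l ∧ ¬ M l = 0} = (2 * m) ^ 2 + 2 * m := by
      rw [← h1 p, ← card_filter_add_card_filter_not (s := {l | I p l}) (fun l => M l = 0),
        filter_filter, filter_filter]
    replace hsplit : (#{l | I p l ∧ M l = 0} + #{l | I p l ∧ ¬ M l = 0} : ℤ) =
        (2 * m) ^ 2 + 2 * m := by exact_mod_cast hsplit
    have hsum : ((∑ l with I p l, M l : ℕ) : ℤ) = #{l | I p l ∧ ¬ M l = 0} * (2 * m ^ 2) := by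
      rw [sum_congr rfl (fun l _ => hM2 l), sum_ite, sum_const_zero, zero_add, sum_const,
        filter_filter]
      simp
    rw [hS, hUeq] at hsum
    by_cases hp : κ p = 0
    · rw [hp] at hsum
      have : (#{l | I p l ∧ ¬ M l = 0} : ℤ) = (2 * m) ^ 2 + 2 * m - 2 := by
        apply mul_right_cancel₀ hm2
        rw [← hsum]
        push_cast
        ring
      have : (#{l | I p l ∧ M l = 0} : ℤ) = 2 := by linarith
      rw [show #{l | I p l ∧ M l = 0} = 2 by exact_mod_cast this]
      exact even_two
    · rw [hκ1 p hp] at hsum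
      have : (#{l | I p l ∧ ¬ M l = 0} : ℤ) = (2 * m) ^ 2 + 2 * m := by
        apply mul_right_cancel₀ hm2
        rw [← hsum]
        push_cast
        ring
      have : (#{l | I p l ∧ M l = 0} : ℤ) = 0 := by linarith
      rw [Nat.cast_eq_zero.1 this]
      exact Even.zero
  -- Double counting gives `(q^3 - 1)(q + 1)` lines of multiplicity `n`, an odd number, while the
  -- number of all lines is even.
  have hOdd : Odd #{l | M l = 0} := by
    have hsplit : #{l | M l = 0} + #{l | ¬ M l = 0} = Fintype.card L := by
      rw [card_filter_add_card_filter_not, card_univ]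
    have hsum : ∑ l, M l = #{l | ¬ M l = 0} * (2 * m ^ 2) := by
      rw [sum_congr rfl (fun l _ => hM2 l), sum_ite, sum_const_zero, zero_add, sum_const]
      simp
    have hdouble : ∑ l, M l = (∑ p, κ p) * ((2 * m) ^ 2 + 2 * m) := by
      simp only [hM, sum_filter]
      rw [sum_comm, sum_mul]
      refine sum_congr rfl (fun p _ => ?_)
      rw [← sum_filter, sum_const, h1, smul_eq_mul, mul_comm]
    have hne : (#{l | ¬ M l = 0} : ℤ) = (8 * m ^ 3 - 1) * (2 * m + 1) := by
      apply mul_right_cancel₀ hm2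
      have : ((∑ l, M l : ℕ) : ℤ) = (8 * m ^ 4 - m) * ((2 * m) ^ 2 + 2 * m) := by
        rw [hdouble, ← hk]
        push_cast
        ring
      rw [hsum] at this
      push_cast at this
      rw [this]
      ring
    have hodd : Odd (#{l | ¬ M l = 0} : ℤ) := by
      rw [hne]
      refine Odd.mul ?_ ⟨m, rfl⟩
      exact ⟨4 * m ^ 3 - 1, by ring⟩
    rw [Int.odd_coe_nat] at hodd
    rw [← hsplit] at hL
    by_contra hcon
    rw [Nat.not_odd_iff_even] at hcon
    exact Nat.not_even_iff_odd.2 hodd ((Nat.even_add.1 hL).1 hcon)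
  have hcomm : ∑ x : τ, #{l | I (t x) l ∧ M l = 0} = ∑ l with M l = 0, #{x | I (t x) l} := by
    simp only [card_filter, sum_filter]
    rw [sum_comm]
    refine sum_congr rfl (fun l _ => ?_)
    split_ifs with h <;> simp [h]
  have hE : Even (∑ x : τ, #{l | I (t x) l ∧ M l = 0}) := even_sum _ fun x _ => hEven (t x)
  rw [hcomm, ← Nat.not_odd_iff_even] at hE
  apply hE
  rw [odd_sum_iff_odd_card_odd, filter_true_of_mem (fun l _ => hT l)]
  exact hOdd

end HjelmslevCounting

/-! ### Counting solutions of linear equations in `F³` -/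

section LinearCounting

open Finset
open scoped Classical

/-- All fibres of a surjective additive map between finite groups have the same size. -/
theorem card_fiber_mul_card_of_surjective {A B : Type*} [AddGroup A] [AddGroup B] [Fintype A]
    [Fintype B] (f : A →+ B) (hf : Function.Surjective f) (y : B) :
    #{x | f x = y} * Fintype.card B = Fintype.card A := by
  have h : ∀ z ∈ (univ : Finset B), #{x | f x = z} = #{x | f x = y} := fun z _ =>
    AddMonoidHom.card_fiber_eq_of_mem_range f (hf z) (hf y)
  have e := card_eq_sum_card_fiberwise (f := f) (s := univ) (t := univ) (by simp)
  rw [← card_univ (α := A), e, sum_congr rfl h, sum_const, card_univ, smul_eq_mul, mul_comm]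

theorem card_filter_prod_of_card_eq {A B : Type*} [Fintype A] [Fintype B] {p : A → Prop}
    {r : A → B → Prop} [DecidablePred p] [∀ a, DecidablePred (r a)] {n : ℕ}
    (h : ∀ a, p a → #{b | r a b} = n) :
    #{x : A × B | p x.1 ∧ r x.1 x.2} = #{a | p a} * n := by
  rw [card_filter, Fintype.sum_prod_type, ← smul_eq_mul, ← sum_const, sum_filter]
  refine sum_congr rfl (fun a _ => ?_)
  by_cases ha : p a
  · simp only [ha, true_and, if_true]
    rw [← h a ha, card_filter]
  · simp [ha]

variable {F : Type*} [Field F] [Fintype F]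

/-- Independent coefficient vectors make the system map surjective, so all its fibres have equal
size. -/
theorem card_dotProduct_eq {k : ℕ} {a : Fin k → Fin 3 → F} (ha : LinearIndependent F a)
    (c : Fin k → F) :
    #{x | ∀ i, x ⬝ᵥ a i = c i} * Fintype.card F ^ k = Fintype.card F ^ 3 := by
  have hs : Function.Surjective (Matrix.of a).mulVecLin := by
    rw [← LinearMap.range_eq_top]
    apply Submodule.eq_top_of_finrank_eq
    have := LinearIndependent.rank_matrix (M := Matrix.of a) ha
    rw [Matrix.rank] at this
    simpa using this
  have h := card_fiber_mul_card_of_surjective (Matrix.of a).mulVecLin.toAddMonoidHom hs c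
  rw [Fintype.card_fun, Fintype.card_fun, Fintype.card_fin, Fintype.card_fin] at h
  rw [← h]
  congr 2
  ext x
  simp only [mem_filter, mem_univ, true_and]
  constructor
  · intro hx
    funext i
    rw [← hx i, dotProduct_comm]
    rfl
  · rintro rfl i
    rw [dotProduct_comm]
    rfl

theorem card_dotProduct_eq_one {a : Fin 3 → F} (ha : a ≠ 0) (c : F) :
    #{x | x ⬝ᵥ a = c} = Fintype.card F ^ 2 := by
  have h := card_dotProduct_eq (a := ![a]) (by simpa using! ha) ![c]
  simp only [Fin.forall_fin_one, Matrix.cons_val_fin_one] at h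
  have : Fintype.card F ≠ 0 := Fintype.card_ne_zero
  apply mul_right_cancel₀ (pow_ne_zero 1 this)
  rw [h]
  ring

theorem card_dotProduct_eq_two {a b : Fin 3 → F} (hab : LinearIndependent F ![a, b]) (c d : F) :
    #{x | x ⬝ᵥ a = c ∧ x ⬝ᵥ b = d} = Fintype.card F := by
  have h := card_dotProduct_eq hab ![c, d]
  simp only [Fin.forall_fin_two, Matrix.cons_val_zero, Matrix.cons_val_one] at h
  have : Fintype.card F ≠ 0 := Fintype.card_ne_zero
  apply mul_right_cancel₀ (pow_ne_zero 2 this)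
  rw [h]
  ring

theorem card_ne_zero_and {A : Type*} [Fintype A] [Zero A] [DecidableEq A] {p : A → Prop}
    [DecidablePred p] (h0 : p 0) :
    #{x | x ≠ 0 ∧ p x} + 1 = #{x | p x} := by
  rw [← card_erase_add_one (s := {x | p x}) (a := 0) (by simpa using h0)]
  congr 2
  ext x
  simp

/-- Every two homogeneous linear equations over a field of even order have an odd number of nonzero
solutions in dimension three. -/
theorem odd_card_ne_zero_orthogonal (hF : Even (Fintype.card F)) (u w : Fin 3 → F) :
    Odd #{x | x ≠ 0 ∧ (u ⬝ᵥ x = 0 ∧ w ⬝ᵥ x = 0)} := by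
  have h : #{x | x ≠ 0 ∧ (u ⬝ᵥ x = 0 ∧ w ⬝ᵥ x = 0)} + 1 = #{x | u ⬝ᵥ x = 0 ∧ w ⬝ᵥ x = 0} := by
    exact card_ne_zero_and (p := fun x => u ⬝ᵥ x = 0 ∧ w ⬝ᵥ x = 0) (by simp)
  have hev : Even #{x | u ⬝ᵥ x = 0 ∧ w ⬝ᵥ x = 0} := by
    set K := LinearMap.ker (Matrix.of ![u, w]).mulVecLin
    have hK : #{x | u ⬝ᵥ x = 0 ∧ w ⬝ᵥ x = 0} = Fintype.card K := by
      rw [Fintype.card_subtype]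
      congr 1
      ext x
      simp [K, funext_iff, Fin.forall_fin_two]
    rw [hK, Module.card_eq_pow_finrank (K := F)]
    refine hF.pow_of_ne_zero ?_
    -- Two equations in three unknowns leave a kernel of positive dimension, hence of even
    -- cardinality.
    have := LinearMap.finrank_range_add_finrank_ker (Matrix.of ![u, w]).mulVecLin
    have h2 := Submodule.finrank_le (LinearMap.range (Matrix.of ![u, w]).mulVecLin)
    rw [Module.finrank_fin_fun] at this h2
    intro h0
    exact absurd ((this.symm.trans (congrArg (_ + ·) h0)).trans_le h2) (by norm_num)
  rw [← h] at hev
  by_contra hcon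
  rw [Nat.not_odd_iff_even] at hcon
  exact Nat.not_even_iff_odd.2 hcon.add_one hev

end LinearCounting

/-! ### Twisted dual numbers -/

/-- A presentation of a ring `R` as `F ⊕ F ε` with `ε ^ 2 = 0` and `ε a = σ(a) ε`. -/
structure TwistedDual (F R : Type*) [Field F] [Ring R] (σ : F ≃+* F) where
  ι : F →+* R
  ε : R
  ε_mul : ∀ a, ε * ι a = ι (σ a) * ε
  ε_sq : ε * ε = 0
  bij : Function.Bijective fun x : F × F => ι x.1 + ι x.2 * ε

/-! ### Truncated skew polynomials as twisted dual numbers -/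

namespace TruncSkewPoly

variable {F : Type*} [Field F] (σ : F ≃+* F)

theorem skewAction_smul (n : ℕ) (a : F) :
    letI := skewAction σ
    Multiplicative.ofAdd n • a = (σ ^ n : RingAut F) a := rfl

theorem matrixUnit_sq : (!![0, 1; 0, 0] : Matrix (Fin 2) (Fin 2) F) ^ 2 = 0 := by
  ext i j
  fin_cases i <;> fin_cases j <;> simp [sq]

/-- The representation of skew polynomials by triangular matrices over `F` that sends `a` to
`diag(a, σ a)` and `X` to a nilpotent matrix unit. -/
noncomputable def toMatrix :
    letI := skewAction σ
    SkewPolynomial F →+* Matrix (Fin 2) (Fin 2) F :=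
  letI := skewAction σ
  SkewMonoidAlgebra.liftNCRingHom
    ((Matrix.diagonalRingHom (Fin 2) F).comp (RingHom.pi ![RingHom.id F, (σ : F →+* F)]))
    (powersHom (Matrix (Fin 2) (Fin 2) F) !![0, 1; 0, 0]) (by
      intro a y
      induction y using Multiplicative.rec with | _ n =>
      rw [skewAction_smul, powersHom_apply, toAdd_ofAdd]
      induction n with
      | zero => simp
      | succ n ih =>
        -- Moving the matrix unit past `diag(a, σ a)` uses `σ` exactly once; all higher powers
        -- vanish.
        rcases n with _ | n
        · ext i j
          fin_cases i <;> fin_cases j <;> simp [Matrix.mul_apply]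
        · have : (!![0, 1; 0, 0] : Matrix (Fin 2) (Fin 2) F) ^ (n + 1 + 1) = 0 := by
            rw [add_assoc, pow_add, matrixUnit_sq, mul_zero]
          rw [this]
          simp)

theorem toMatrix_monomial (n : ℕ) (a : F) :
    toMatrix σ (SkewPolynomial.monomial n a) =
      Matrix.diagonal ![a, σ a] * !![0, 1; 0, 0] ^ n := by
  let := skewAction σ
  change SkewMonoidAlgebra.liftNC _ _ (SkewMonoidAlgebra.single _ _) = _
  rw [SkewMonoidAlgebra.liftNC_single]
  congr 1
  change Matrix.diagonal _ = _
  congr 1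
  ext i
  fin_cases i <;> rfl

/-- The quotient map onto the truncated skew polynomial ring. -/
noncomputable def mk :
    letI := skewAction σ
    SkewPolynomial F →+* TruncSkewPoly F σ :=
  letI := skewAction σ
  (TwoSidedIdeal.span {(SkewPolynomial.X : SkewPolynomial F) ^ 2}).ringCon.mk'

theorem mk_surjective : Function.Surjective (mk σ) :=
  Quotient.mk_surjective

theorem mk_X_sq :
    letI := skewAction σ
    mk σ SkewPolynomial.X * mk σ SkewPolynomial.X = 0 := by
  let := skewAction σ
  rw [← map_mul, ← sq]
  exact (RingCon.eq _).2 (TwoSidedIdeal.subset_span (Set.mem_singleton _))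

/-- The matrix representation kills `X ^ 2`, so it factors through the quotient. Its first row
recovers the coefficients in degrees `0` and `1`, which keeps them distinct in the quotient. -/
theorem toMatrix_eq_of_mk_eq {p p' : SkewPolynomial F} (h : mk σ p = mk σ p') :
    toMatrix σ p = toMatrix σ p' := by
  let := skewAction σ
  have h1 := (RingCon.eq _).1 h
  rw [TwoSidedIdeal.rel_iff] at h1
  have h2 : TwoSidedIdeal.span {(SkewPolynomial.X : SkewPolynomial F) ^ 2} ≤
      TwoSidedIdeal.ker (toMatrix σ) := by
    rw [TwoSidedIdeal.span_le, Set.singleton_subset_iff]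
    change _ ∈ TwoSidedIdeal.ker (toMatrix σ)
    rw [TwoSidedIdeal.mem_ker, ← SkewPolynomial.monomial_one_right_eq_X_pow, toMatrix_monomial,
      matrixUnit_sq, mul_zero]
  have h3 := h2 h1
  rw [TwoSidedIdeal.mem_ker, map_sub, sub_eq_zero] at h3
  exact h3

theorem mk_monomial_add_two (n : ℕ) (a : F) : mk σ (SkewPolynomial.monomial (n + 2) a) = 0 := by
  let := skewAction σ
  rw [← SkewPolynomial.monomial_mul_X_pow, sq, map_mul, map_mul, mk_X_sq, mul_zero]

/-- Truncated skew polynomials of degree two are twisted dual numbers. -/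
noncomputable def twistedDual : TwistedDual F (TruncSkewPoly F σ) σ :=
  letI := skewAction σ
  { ι := (mk σ).comp SkewPolynomial.CRingHom
    ε := mk σ SkewPolynomial.X
    ε_mul := fun a => by
      simp only [RingHom.comp_apply, ← map_mul]
      congr 1
      rw [SkewPolynomial.CRingHom_eq_C, SkewPolynomial.CRingHom_eq_C,
        ← SkewPolynomial.monomial_one_one_eq_X, SkewPolynomial.monomial_mul_C,
        SkewPolynomial.C_mul_monomial]
      simp only [one_mul, mul_one]
      rfl
    ε_sq := mk_X_sq σ
    bij := by
      have key : ∀ a b : F, ((mk σ).comp SkewPolynomial.CRingHom) a +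
          ((mk σ).comp SkewPolynomial.CRingHom) b * mk σ SkewPolynomial.X =
          mk σ (SkewPolynomial.monomial 0 a + SkewPolynomial.monomial 1 b) := by
        intro a b
        simp only [RingHom.comp_apply, ← map_mul, ← map_add, SkewPolynomial.CRingHom_eq_C,
          ← SkewPolynomial.monomial_zero_left, SkewPolynomial.monomial_mul_X, zero_add]
      constructor
      · rintro ⟨a, b⟩ ⟨a', b'⟩ h
        simp only [key] at h
        have h' := toMatrix_eq_of_mk_eq σ h
        rw [map_add, map_add, toMatrix_monomial, toMatrix_monomial, toMatrix_monomial,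
          toMatrix_monomial] at h'
        have h0 := congrFun (congrFun h' 0) 0
        have h1 := congrFun (congrFun h' 0) 1
        simp at h0 h1
        rw [h0, h1]
      · intro r
        obtain ⟨p, rfl⟩ := mk_surjective σ r
        simp only [key]
        induction p using SkewPolynomial.induction with
        | h0 => exact ⟨0, by simp⟩
        | ha n a p _ _ ih =>
          obtain ⟨⟨b, c⟩, h⟩ := ih
          rw [map_add, ← h]
          rcases n with _ | _ | n
          · refine ⟨⟨a + b, c⟩, ?_⟩
            rw [← map_add, SkewPolynomial.monomial_add, add_assoc]
          · refine ⟨⟨b, a + c⟩, ?_⟩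
            rw [← map_add, SkewPolynomial.monomial_add]
            congr 1
            simp only [zero_add]
            abel
          · refine ⟨⟨b, c⟩, ?_⟩
            rw [mk_monomial_add_two, zero_add] }

end TruncSkewPoly

/-! ### Incidence numbers in coordinates over `F` -/

section IncidenceCounting

open Finset
open scoped Classical

variable {F : Type*} [Field F] (σ : F ≃+* F)

/-- The point with coordinates `a + b ε` lies on the line with coordinates `u + w ε`. -/
def TwistedIncident (a b : Fin 3 → F) (x : (Fin 3 → F) × (Fin 3 → F)) : Prop :=
  x.1 ⬝ᵥ a = 0 ∧ x.1 ⬝ᵥ b + x.2 ⬝ᵥ (σ ∘ a) = 0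

theorem linearIndependent_pair_comp {a a' : Fin 3 → F} (h : LinearIndependent F ![a, a']) :
    LinearIndependent F ![σ ∘ a, σ ∘ a'] := by
  rw [LinearIndependent.pair_iff] at h ⊢
  intro s t hst
  have := h (σ.symm s) (σ.symm t) (by
    ext i
    apply σ.injective
    simpa using congrFun hst i)
  simpa using this

theorem comp_ne_zero_of_ne_zero {a : Fin 3 → F} (ha : a ≠ 0) : σ ∘ a ≠ 0 := by
  contrapose! ha
  ext i
  apply σ.injective
  simpa using congrFun ha i

variable [Fintype F]

theorem card_lines_coordinates :
    #{x : (Fin 3 → F) × (Fin 3 → F) | x.1 ≠ 0} =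
      (Fintype.card F ^ 3 - 1) * Fintype.card F ^ 3 := by
  have h := card_filter_prod_of_card_eq (A := Fin 3 → F) (B := Fin 3 → F) (p := fun u => u ≠ 0)
    (r := fun _ _ => True) (n := Fintype.card F ^ 3) (by simp)
  simpa [filter_ne', card_erase_of_mem] using h

theorem card_lines_through_point {a : Fin 3 → F} (ha : a ≠ 0) (b : Fin 3 → F) :
    #{x | x.1 ≠ 0 ∧ TwistedIncident σ a b x} =
      (Fintype.card F ^ 2 - 1) * Fintype.card F ^ 2 := by
  have h := card_filter_prod_of_card_eq (A := Fin 3 → F) (B := Fin 3 → F)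
    (p := fun u => u ≠ 0 ∧ u ⬝ᵥ a = 0) (r := fun u w => w ⬝ᵥ (σ ∘ a) = -(u ⬝ᵥ b))
    (n := Fintype.card F ^ 2)
    (fun u _ => card_dotProduct_eq_one (comp_ne_zero_of_ne_zero σ ha) _)
  have h' := card_ne_zero_and (p := fun u => u ⬝ᵥ a = 0) (zero_dotProduct a)
  rw [card_dotProduct_eq_one ha] at h'
  have h4 : #{u : Fin 3 → F | u ≠ 0 ∧ u ⬝ᵥ a = 0} = Fintype.card F ^ 2 - 1 :=
    Nat.eq_sub_of_add_eq h'
  rw [← h4]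
  convert h using 2
  ext x
  rw [mem_filter, mem_filter]
  simp only [mem_univ, true_and, TwistedIncident, and_assoc, eq_neg_iff_add_eq_zero, add_comm]

/-- The vector `u` ranges over the nonzero elements of a one-dimensional space; each `u` leaves two
independent affine equations for `w`. -/
theorem card_lines_through_two_points {a a' : Fin 3 → F} (h : LinearIndependent F ![a, a'])
    (b b' : Fin 3 → F) :
    #{x | x.1 ≠ 0 ∧ TwistedIncident σ a b x ∧ TwistedIncident σ a' b' x} =
      (Fintype.card F - 1) * Fintype.card F := by
  have h1 := card_filter_prod_of_card_eq (A := Fin 3 → F) (B := Fin 3 → F)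
    (p := fun u => u ≠ 0 ∧ (u ⬝ᵥ a = 0 ∧ u ⬝ᵥ a' = 0))
    (r := fun u w => w ⬝ᵥ (σ ∘ a) = -(u ⬝ᵥ b) ∧ w ⬝ᵥ (σ ∘ a') = -(u ⬝ᵥ b'))
    (n := Fintype.card F)
    (fun u _ => by
      convert card_dotProduct_eq_two (linearIndependent_pair_comp σ h) _ _)
  have h2 := card_ne_zero_and (p := fun u => u ⬝ᵥ a = 0 ∧ u ⬝ᵥ a' = 0) (by simp)
  have h3 : #{u | u ⬝ᵥ a = 0 ∧ u ⬝ᵥ a' = 0} = Fintype.card F := card_dotProduct_eq_two h 0 0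
  have h4 : #{u : Fin 3 → F | u ≠ 0 ∧ (u ⬝ᵥ a = 0 ∧ u ⬝ᵥ a' = 0)} = Fintype.card F - 1 := by
    rw [← h3]
    exact Nat.eq_sub_of_add_eq h2
  rw [← h4]
  convert h1 using 2
  ext x
  rw [mem_filter, mem_filter]
  simp only [mem_univ, true_and, TwistedIncident, eq_neg_iff_add_eq_zero, add_comm]
  tauto

/-- Subtracting `σ l` times the first `ε`-equation from the second leaves `u ⬝ᵥ d = 0`. So `u`
satisfies two equations and `w` only one, which yields the extra factor `q` over non-neighbours. -/
theorem card_lines_through_two_neighbors {a d : Fin 3 → F} (h : LinearIndependent F ![a, d])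
    (b : Fin 3 → F) {l : F} :
    #{x | x.1 ≠ 0 ∧ TwistedIncident σ a b x ∧ TwistedIncident σ (l • a) (σ l • b + d) x} =
      (Fintype.card F - 1) * Fintype.card F ^ 2 := by
  have ha : a ≠ 0 := h.ne_zero 0
  have h1 := card_filter_prod_of_card_eq (A := Fin 3 → F) (B := Fin 3 → F)
    (p := fun u => u ≠ 0 ∧ (u ⬝ᵥ a = 0 ∧ u ⬝ᵥ d = 0))
    (r := fun u w => w ⬝ᵥ (σ ∘ a) = -(u ⬝ᵥ b)) (n := Fintype.card F ^ 2)
    (fun u _ => card_dotProduct_eq_one (comp_ne_zero_of_ne_zero σ ha) _)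
  have h2 := card_ne_zero_and (p := fun u => u ⬝ᵥ a = 0 ∧ u ⬝ᵥ d = 0) (by simp)
  have h3 : #{u | u ⬝ᵥ a = 0 ∧ u ⬝ᵥ d = 0} = Fintype.card F := card_dotProduct_eq_two h 0 0
  have h4 : #{u : Fin 3 → F | u ≠ 0 ∧ (u ⬝ᵥ a = 0 ∧ u ⬝ᵥ d = 0)} = Fintype.card F - 1 := by
    rw [← h3]
    exact Nat.eq_sub_of_add_eq h2
  rw [← h4]
  convert h1 using 2
  ext x
  have hl : σ ∘ (l • a) = σ l • (σ ∘ a) := by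
    ext i
    simp
  rw [mem_filter, mem_filter]
  simp only [mem_univ, true_and, TwistedIncident, eq_neg_iff_add_eq_zero, hl,
    dotProduct_smul, dotProduct_add, smul_eq_mul]
  constructor
  · rintro ⟨h0, ⟨h1, h2⟩, -, h3⟩
    refine ⟨⟨h0, h1, ?_⟩, by rw [add_comm, h2]⟩
    linear_combination h3 - σ l * h2
  · rintro ⟨⟨h0, h1, h2⟩, h3⟩
    refine ⟨h0, ⟨h1, by rw [add_comm, h3]⟩, by rw [h1, mul_zero], ?_⟩
    linear_combination h2 + σ l * h3

end IncidenceCounting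

/-! ### Points and lines over twisted dual numbers -/

namespace TwistedDual

variable {F R : Type*} [Field F] [Ring R] {σ : F ≃+* F} (D : TwistedDual F R σ)

/-- The vector `a + b ε`. -/
def vec (a b : Fin 3 → F) : Fin 3 → R := fun i => D.ι (a i) + D.ι (b i) * D.ε

/-- The scalar `l + m ε`, acting from the right. -/
def scal (l m : F) : Rᵐᵒᵖ := MulOpposite.op (D.ι l + D.ι m * D.ε)

theorem mul_formula (a b c d : F) :
    (D.ι a + D.ι b * D.ε) * (D.ι c + D.ι d * D.ε) =
      D.ι (a * c) + D.ι (a * d + b * σ c) * D.ε := by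
  have h1 : D.ι b * D.ε * D.ι c = D.ι b * D.ι (σ c) * D.ε := by
    rw [mul_assoc, D.ε_mul, mul_assoc]
  have h2 : D.ι b * D.ε * (D.ι d * D.ε) = 0 := by
    rw [mul_assoc, ← mul_assoc D.ε, D.ε_mul, mul_assoc, D.ε_sq, mul_zero, mul_zero]
  rw [add_mul, mul_add, mul_add, h1, h2, map_add, map_mul, map_mul, map_mul, add_mul, add_zero,
    add_assoc, mul_assoc (D.ι a)]

theorem scal_smul_vec (l m : F) (a b : Fin 3 → F) :
    D.scal l m • D.vec a b = D.vec (l • a) (m • a + σ l • b) := by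
  ext i
  simp only [scal, vec, Pi.smul_apply, op_smul_eq_mul, mul_formula, Pi.add_apply, smul_eq_mul,
    mul_comm]

theorem vec_add (a b a' b' : Fin 3 → F) :
    D.vec a b + D.vec a' b' = D.vec (a + a') (b + b') := by
  ext i
  simp only [vec, Pi.add_apply, map_add, add_mul]
  abel

theorem vec_zero : D.vec 0 0 = 0 := by
  ext i
  simp [vec]

theorem scal_zero : D.scal 0 0 = 0 := by
  simp [scal]

theorem vec_inj {a b a' b' : Fin 3 → F} : D.vec a b = D.vec a' b' ↔ a = a' ∧ b = b' := by
  constructor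
  · intro h
    have := fun i => D.bij.1 (a₁ := (a i, b i)) (a₂ := (a' i, b' i)) (congrFun h i)
    simp only [Prod.mk.injEq] at this
    exact ⟨funext fun i => (this i).1, funext fun i => (this i).2⟩
  · rintro ⟨rfl, rfl⟩
    rfl

theorem exists_vec (v : Fin 3 → R) : ∃ a b, v = D.vec a b := by
  choose f hf using fun i => D.bij.2 (v i)
  exact ⟨fun i => (f i).1, fun i => (f i).2, funext fun i => (hf i).symm⟩

theorem exists_scal (r : Rᵐᵒᵖ) : ∃ l m, r = D.scal l m := by
  obtain ⟨⟨l, m⟩, h⟩ := D.bij.2 r.unop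
  exact ⟨l, m, MulOpposite.unop_injective h.symm⟩

/-- The constant part of a relation kills all `l i`; the twisted terms then disappear and the
`ε`-part kills all `m i`. -/
theorem linearIndependent_vec {d : ℕ} {a : Fin d → Fin 3 → F} (ha : LinearIndependent F a)
    (b : Fin d → Fin 3 → F) : LinearIndependent Rᵐᵒᵖ fun i => D.vec (a i) (b i) := by
  rw [Fintype.linearIndependent_iff] at ha ⊢
  intro g hg
  choose l m hlm using fun i => D.exists_scal (g i)
  have hsum : ∀ s : Finset (Fin d), ∑ i ∈ s, g i • D.vec (a i) (b i) =
      D.vec (∑ i ∈ s, l i • a i) (∑ i ∈ s, (m i • a i + σ (l i) • b i)) := by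
    classical
    intro s
    induction s using Finset.induction_on with
    | empty => simp [vec_zero]
    | insert i s hi ih =>
      rw [Finset.sum_insert hi, Finset.sum_insert hi, Finset.sum_insert hi, ih, hlm,
        scal_smul_vec, vec_add]
  rw [hsum, ← D.vec_zero, vec_inj] at hg
  have hl := ha l hg.1
  have hm := ha m (by simpa [hl] using hg.2)
  intro i
  rw [hlm, hl, hm, scal_zero]

/-- The submodule spanned by a vector. -/
def point (a b : Fin 3 → F) : Submodule Rᵐᵒᵖ (Fin 3 → R) := Rᵐᵒᵖ ∙ D.vec a b

theorem vec_mem_point {a b a' b' : Fin 3 → F} :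
    D.vec a' b' ∈ D.point a b ↔ ∃ l m : F, a' = l • a ∧ b' = m • a + σ l • b := by
  rw [point, Submodule.mem_span_singleton]
  constructor
  · rintro ⟨r, hr⟩
    obtain ⟨l, m, rfl⟩ := D.exists_scal r
    rw [scal_smul_vec, vec_inj] at hr
    exact ⟨l, m, hr.1.symm, hr.2.symm⟩
  · rintro ⟨l, m, rfl, rfl⟩
    exact ⟨D.scal l m, D.scal_smul_vec l m a b⟩

theorem nonempty_basis_point {a : Fin 3 → F} (ha : a ≠ 0) (b : Fin 3 → F) :
    Nonempty (Module.Basis (Fin 1) Rᵐᵒᵖ (D.point a b)) := by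
  have h := D.linearIndependent_vec (a := ![a]) (by simpa using! ha) ![b]
  have e : Submodule.span Rᵐᵒᵖ (Set.range fun i => D.vec (![a] i) (![b] i)) = D.point a b := by
    rw [Set.range_unique]
    rfl
  exact e ▸ ⟨Module.Basis.span h⟩

/-- If `a = 0`, right multiplication by `ε` annihilates the generator, contradicting freeness. -/
theorem exists_eq_point (P : PHG.Point R) : ∃ a b, a ≠ 0 ∧ P.1 = D.point a b := by
  obtain ⟨U, ⟨e⟩⟩ := P
  obtain ⟨a, b, hab⟩ := D.exists_vec (e 0 : Fin 3 → R)
  refine ⟨a, b, ?_, ?_⟩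
  · rintro rfl
    have h : D.scal 0 1 • e 0 = 0 := by
      apply Subtype.ext
      rw [Submodule.coe_smul, hab, scal_smul_vec, Submodule.coe_zero, ← D.vec_zero, vec_inj]
      simp
    have h2 := Fintype.linearIndependent_iff.1 e.linearIndependent (fun _ => D.scal 0 1)
      (by simpa using h) 0
    rw [← D.scal_zero] at h2
    have h3 := D.bij.1 (a₁ := (0, 1)) (a₂ := (0, 0)) (MulOpposite.op_injective h2)
    simp at h3
  · have h := congrArg (Submodule.map U.subtype) e.span_eq
    rw [Set.range_unique, Submodule.map_span, Submodule.map_subtype_top, Set.image_singleton] at h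
    rw [point, ← hab]
    exact h.symm

/-- The submodule of the solutions of the linear equation with coefficients `u + w ε`. -/
def line (u w : Fin 3 → F) : Submodule Rᵐᵒᵖ (Fin 3 → R) where
  carrier := {v | D.vec u w ⬝ᵥ v = 0}
  zero_mem' := dotProduct_zero _
  add_mem' := fun {v v'} hv hv' => by
    rw [Set.mem_ofPred_eq] at *
    rw [dotProduct_add, hv, hv', add_zero]
  smul_mem' := fun r v hv => by
    rw [Set.mem_ofPred_eq] at *
    rw [dotProduct_smul, hv, smul_zero]

theorem vec_mem_line {u w a b : Fin 3 → F} :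
    D.vec a b ∈ D.line u w ↔ TwistedIncident σ a b (u, w) := by
  have h : D.vec u w ⬝ᵥ D.vec a b =
      D.ι (u ⬝ᵥ a) + D.ι (u ⬝ᵥ b + w ⬝ᵥ (σ ∘ a)) * D.ε := by
    simp only [dotProduct, vec, mul_formula, Finset.sum_add_distrib, ← Finset.sum_mul, map_sum,
      map_add, Function.comp_apply]
  change D.vec u w ⬝ᵥ D.vec a b = 0 ↔ _
  rw [h]
  constructor
  · intro h
    have := D.bij.1 (a₁ := (u ⬝ᵥ a, u ⬝ᵥ b + w ⬝ᵥ (σ ∘ a))) (a₂ := (0, 0)) (by simpa using h)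
    simpa [TwistedIncident] using this
  · rintro ⟨h1, h2⟩
    simp only at h1 h2
    simp [h1, h2]

theorem finrank_ker_dotProduct {u : Fin 3 → F} (hu : u ≠ 0) :
    Module.finrank F (LinearMap.ker (dotProductBilin F F u)) = 2 := by
  have hne : dotProductBilin F F u ≠ 0 := by
    intro h
    apply hu
    apply dotProduct_eq_zero
    intro w
    exact congrArg (fun f : (Fin 3 → F) →ₗ[F] F => f w) h
  have h := Module.Dual.finrank_ker_add_one_of_ne_zero hne
  rw [Module.finrank_fin_fun] at h
  omega

theorem span_pair_eq_orthogonal {u a a' : Fin 3 → F} (hu : u ≠ 0)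
    (h : LinearIndependent F ![a, a']) (ha : u ⬝ᵥ a = 0) (ha' : u ⬝ᵥ a' = 0) {x : Fin 3 → F}
    (hx : u ⬝ᵥ x = 0) : ∃ s t : F, s • a + t • a' = x := by
  rw [← Submodule.mem_span_pair]
  have hle : Submodule.span F {a, a'} ≤ LinearMap.ker (dotProductBilin F F u) := by
    rw [Submodule.span_le]
    rintro y (rfl | rfl)
    exacts [ha, ha']
  have heq := Submodule.eq_of_le_of_finrank_eq hle (by
    have := finrank_span_eq_card h
    rw [Matrix.range_cons_cons_empty] at this
    rw [finrank_ker_dotProduct hu, this, Fintype.card_fin])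
  rw [heq]
  exact hx

theorem line_eq_span {u w a b a' b' : Fin 3 → F} (hu : u ≠ 0)
    (h : LinearIndependent F ![a, a']) (h1 : D.vec a b ∈ D.line u w)
    (h2 : D.vec a' b' ∈ D.line u w) :
    D.line u w = Submodule.span Rᵐᵒᵖ {D.vec a b, D.vec a' b'} := by
  apply le_antisymm
  · intro v hv
    obtain ⟨x, y, rfl⟩ := D.exists_vec v
    rw [vec_mem_line] at h1 h2 hv
    obtain ⟨s, t, hst⟩ := span_pair_eq_orthogonal hu h h1.1 h2.1 hv.1
    -- After the constant parts are matched, the remaining `ε`-part is again orthogonal to `u`, so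
    -- it is a combination of the same `a`, `a'`.
    have hy : u ⬝ᵥ (y - σ s • b - σ t • b') = 0 := by
      have e0 := hv.2
      have e1 := h1.2
      have e2 := h2.2
      have e3 : σ ∘ x = σ s • (σ ∘ a) + σ t • (σ ∘ a') := by
        rw [← hst]
        ext i
        simp
      rw [e3] at e0
      simp only [dotProduct_add, dotProduct_smul, dotProduct_sub, smul_eq_mul] at e0 e1 e2 ⊢
      linear_combination e0 - σ s * e1 - σ t * e2
    obtain ⟨s', t', hst'⟩ := span_pair_eq_orthogonal hu h h1.1 h2.1 hy
    rw [Submodule.mem_span_pair]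
    refine ⟨D.scal s s', D.scal t t', ?_⟩
    rw [scal_smul_vec, scal_smul_vec, vec_add, vec_inj]
    refine ⟨hst, ?_⟩
    rw [eq_sub_iff_add_eq, eq_sub_iff_add_eq] at hst'
    rw [← hst']
    abel
  · rw [Submodule.span_le]
    rintro y (rfl | rfl)
    exacts [h1, h2]

theorem exists_vec_mem_line {u : Fin 3 → F} (hu : u ≠ 0) (w : Fin 3 → F) :
    ∃ a b a' b', LinearIndependent F ![a, a'] ∧ D.vec a b ∈ D.line u w ∧
      D.vec a' b' ∈ D.line u w := by
  let e := Module.finBasisOfFinrankEq F _ (finrank_ker_dotProduct hu)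
  have hli : LinearIndependent F ![(e 0 : Fin 3 → F), (e 1 : Fin 3 → F)] := by
    have := e.linearIndependent.map' (Submodule.subtype _) (Submodule.ker_subtype _)
    have he : Submodule.subtype _ ∘ e = ![(e 0 : Fin 3 → F), (e 1 : Fin 3 → F)] := by
      ext i
      fin_cases i <;> rfl
    rw [← he]
    exact this
  have hex : ∀ c : F, ∃ b : Fin 3 → F, u ⬝ᵥ b = c := by
    obtain ⟨i, hi⟩ := Function.ne_iff.1 hu
    intro c
    refine ⟨Pi.single i ((u i)⁻¹ * c), ?_⟩
    rw [dotProduct_single, mul_inv_cancel_left₀ hi]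
  obtain ⟨b, hb⟩ := hex (-(w ⬝ᵥ (σ ∘ (e 0 : Fin 3 → F))))
  obtain ⟨b', hb'⟩ := hex (-(w ⬝ᵥ (σ ∘ (e 1 : Fin 3 → F))))
  refine ⟨e 0, b, e 1, b', hli, ?_, ?_⟩
  · rw [vec_mem_line]
    exact ⟨(e 0).2, by simp [hb]⟩
  · rw [vec_mem_line]
    exact ⟨(e 1).2, by simp [hb']⟩

/-- Makes the arc bound applicable to lines given by equations. The converse, that every line has an
equation, is not needed. -/
theorem nonempty_basis_line {u : Fin 3 → F} (hu : u ≠ 0) (w : Fin 3 → F) :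
    Nonempty (Module.Basis (Fin 2) Rᵐᵒᵖ (D.line u w)) := by
  obtain ⟨a, b, a', b', hli, h1, h2⟩ := D.exists_vec_mem_line hu w
  have h := D.linearIndependent_vec hli ![b, b']
  have e : Submodule.span Rᵐᵒᵖ (Set.range fun i => D.vec (![a, a'] i) (![b, b'] i)) =
      D.line u w := by
    rw [D.line_eq_span hu hli h1 h2]
    congr 1
    ext x
    simp [Fin.exists_fin_two, eq_comm]
  exact e ▸ ⟨Module.Basis.span h⟩

open Finset in
open scoped Classical in
-- Two non-neighbouring points determine the line, so its equations are exactly those satisfied by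
-- both points.
theorem card_line_fiber [Fintype F] {u : Fin 3 → F} (hu : u ≠ 0) (w : Fin 3 → F) :
    #{x : (Fin 3 → F) × (Fin 3 → F) | x.1 ≠ 0 ∧ D.line x.1 x.2 = D.line u w} =
      (Fintype.card F - 1) * Fintype.card F := by
  obtain ⟨a, b, a', b', hli, h1, h2⟩ := D.exists_vec_mem_line hu w
  rw [← card_lines_through_two_points σ hli b b']
  congr 1
  ext ⟨u', w'⟩
  simp only [mem_filter, mem_univ, true_and, and_congr_right_iff]
  intro hu'
  rw [← vec_mem_line D, ← vec_mem_line D]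
  constructor
  · intro h
    rw [h]
    exact ⟨h1, h2⟩
  · rintro ⟨h3, h4⟩
    rw [D.line_eq_span hu hli h1 h2, D.line_eq_span hu' hli h3 h4]

end TwistedDual

/-! ### The counting argument applied to the plane -/

namespace TwistedDual

open Finset
open scoped Classical

theorem finite {F R : Type*} [Field F] [Ring R] {σ : F ≃+* F} (D : TwistedDual F R σ) [Finite F] :
    Finite R := Finite.of_surjective _ D.bij.2

variable {F R : Type*} [Field F] [Ring R] {σ : F ≃+* F} (D : TwistedDual F R σ)

/-- The lines, described by linear equations. -/
def IsLineEquation (U : Submodule Rᵐᵒᵖ (Fin 3 → R)) : Prop :=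
  ∃ u w, u ≠ 0 ∧ D.line u w = U

theorem le_line_iff {P : Submodule Rᵐᵒᵖ (Fin 3 → R)} {a b u w : Fin 3 → F}
    (hP : P = D.point a b) : P ≤ D.line u w ↔ TwistedIncident σ a b (u, w) := by
  rw [hP, point, Submodule.span_singleton_le_iff_mem, vec_mem_line]

theorem point_smul_eq {a b : Fin 3 → F} {l t : F} (hl : l ≠ 0) :
    D.point (l • a) (t • a + σ l • b) = D.point a b := by
  have hl' : σ l ≠ 0 := by simpa using hl
  apply le_antisymm
  · rw [point, Submodule.span_singleton_le_iff_mem, vec_mem_point]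
    exact ⟨l, t, rfl, rfl⟩
  · rw [point, Submodule.span_singleton_le_iff_mem, vec_mem_point]
    refine ⟨l⁻¹, -((σ l)⁻¹ * t * l⁻¹), ?_, ?_⟩
    · rw [inv_smul_smul₀ hl]
    · ext i
      simp only [Pi.add_apply, Pi.smul_apply, smul_eq_mul, map_inv₀]
      field_simp
      ring

variable [Fintype F]

theorem card_isLineEquation [Fintype {U // D.IsLineEquation U}]
    (Q : Submodule Rᵐᵒᵖ (Fin 3 → R) → Prop) [DecidablePred Q] :
    #{l : {U // D.IsLineEquation U} | Q l} * ((Fintype.card F - 1) * Fintype.card F) =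
      #{x : (Fin 3 → F) × (Fin 3 → F) | x.1 ≠ 0 ∧ Q (D.line x.1 x.2)} := by
  set X : Finset ((Fin 3 → F) × (Fin 3 → F)) := {x | x.1 ≠ 0 ∧ Q (D.line x.1 x.2)} with hX
  set f : (Fin 3 → F) × (Fin 3 → F) → Submodule Rᵐᵒᵖ (Fin 3 → R) := fun x => D.line x.1 x.2
  have h1 : #(image f X) = #{l : {U // D.IsLineEquation U} | Q l} := by
    rw [← card_image_of_injective _ Subtype.val_injective]
    congr 1
    ext U
    simp only [hX, mem_image, mem_filter, mem_univ, true_and, Subtype.exists, exists_and_right,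
      exists_eq_right]
    constructor
    · rintro ⟨x, ⟨h0, hQ⟩, rfl⟩
      exact ⟨⟨x.1, x.2, h0, rfl⟩, hQ⟩
    · rintro ⟨⟨u, w, h0, rfl⟩, hQ⟩
      exact ⟨(u, w), ⟨h0, hQ⟩, rfl⟩
  have h2 : ∀ U ∈ image f X, #{x ∈ X | f x = U} = (Fintype.card F - 1) * Fintype.card F := by
    intro U hU
    obtain ⟨x, hx, rfl⟩ := mem_image.1 hU
    rw [hX, mem_filter] at hx
    rw [← D.card_line_fiber hx.2.1 x.2, hX, filter_filter]
    congr 1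
    ext y
    simp only [mem_filter, mem_univ, true_and]
    constructor
    · rintro ⟨⟨h0, -⟩, h⟩
      exact ⟨h0, h⟩
    · rintro ⟨h0, h⟩
      refine ⟨⟨h0, ?_⟩, h⟩
      rw [h]
      exact hx.2.2
  rw [← h1, card_eq_sum_card_image f X, sum_congr rfl h2, sum_const, smul_eq_mul]

/-- The projective Hjelmslev plane over twisted dual numbers over the field of even order
`q = 2 * m` has no `((q ^ 4 - q) / 2, q ^ 2 / 2)`-arc. -/
theorem not_isArc (D : TwistedDual F R σ) {m : ℕ} (hF : Fintype.card F = 2 * m)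
    (K : Multiset (PHG.Point R)) :
    ¬ PHG.IsArc K (8 * m ^ 4 - m) (2 * m ^ 2) := by
  rintro ⟨hcard, hline⟩
  have hm : 0 < m := by
    have : 0 < Fintype.card F := Fintype.card_pos
    omega
  have := D.finite
  have : Finite (PHG.Point R) := inferInstanceAs (Finite (Subtype _))
  have := Fintype.ofFinite (PHG.Point R)
  have := Fintype.ofFinite {U // D.IsLineEquation U}
  have := Fintype.ofFinite (Projectivization F (Fin 3 → F))
  choose a b ha hP using D.exists_eq_point
  set I : PHG.Point R → {U // D.IsLineEquation U} → Prop := fun P l => P.1 ≤ l.1 with hI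
  have hq : 0 < (Fintype.card F - 1) * Fintype.card F := by
    rw [hF]
    exact Nat.mul_pos (by omega) (by omega)
  obtain ⟨n, hn⟩ : ∃ n, 2 * m = n + 1 := ⟨2 * m - 1, by omega⟩
  -- Neighbour classes are the reductions modulo `ε`. The transversal is indexed by nonzero vectors,
  -- so each of its points is repeated `q - 1` times, which is odd and harmless for parity.
  refine no_maximal_arc_of_odd_transversal (I := I)
    (c := fun P => Projectivization.mk F (a P) (ha P))
    (τ := {x : Fin 3 → F // x ≠ 0})
    (fun x => ⟨D.point x.1 0, D.nonempty_basis_point x.2 0⟩) hm ?_ ?_ ?_ ?_ ?_ ?_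
    (fun P => K.count P) ?_ ?_
  · intro P
    apply Nat.eq_of_mul_eq_mul_right hq
    rw [D.card_isLineEquation (fun U => P.1 ≤ U)]
    simp only [D.le_line_iff (hP P)]
    rw [card_lines_through_point σ (ha P), hF, hn, Nat.add_sub_cancel]
    have : (n + 1) ^ 2 - 1 = n * (n + 2) := by
      rw [Nat.sub_eq_iff_eq_add (Nat.one_le_pow _ _ (by omega))]
      ring
    rw [this]
    ring
  · intro P P' hne hc
    apply Nat.eq_of_mul_eq_mul_right hq
    rw [D.card_isLineEquation (fun U => P.1 ≤ U ∧ P'.1 ≤ U)]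
    simp only [D.le_line_iff (hP P), D.le_line_iff (hP P')]
    obtain ⟨l, hl⟩ := (Projectivization.mk_eq_mk_iff' F _ _ (ha P') (ha P)).1 hc.symm
    have hl0 : l ≠ 0 := by
      rintro rfl
      exact ha P' (by rw [← hl, zero_smul])
    -- If the difference were a multiple of `a P`, the two generators would differ by a unit scalar
    -- and the points would coincide.
    have hli : LinearIndependent F ![a P, b P' - σ l • b P] := by
      rw [LinearIndependent.pair_iff' (ha P)]
      intro t ht
      apply hne
      apply Subtype.ext
      rw [hP P, hP P', ← hl, ← eq_sub_iff_add_eq.1 ht, point_smul_eq D hl0]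
    have h := card_lines_through_two_neighbors σ hli (b P) (l := l)
    rw [add_sub_cancel, hl] at h
    rw [h, hF]
    ring
  · intro P P' hc
    apply Nat.eq_of_mul_eq_mul_right hq
    rw [D.card_isLineEquation (fun U => P.1 ≤ U ∧ P'.1 ≤ U)]
    simp only [D.le_line_iff (hP P), D.le_line_iff (hP P')]
    have hli : LinearIndependent F ![a P, a P'] := by
      rw [LinearIndependent.pair_iff' (ha P)]
      intro t ht
      exact hc ((Projectivization.mk_eq_mk_iff' F _ _ (ha P') (ha P)).2 ⟨t, ht⟩).symm
    rw [card_lines_through_two_points σ hli, one_mul]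
  · have h := D.card_isLineEquation (fun _ => True)
    simp only [and_true, filter_true, card_univ] at h
    rw [card_lines_coordinates, hF] at h
    have : Fintype.card {U // D.IsLineEquation U} =
        (2 * m) ^ 2 * ((2 * m) ^ 2 + 2 * m + 1) := by
      apply Nat.eq_of_mul_eq_mul_right hq
      rw [hF, h, hn, Nat.add_sub_cancel]
      have : (n + 1) ^ 3 - 1 = n * ((n + 1) ^ 2 + (n + 1) + 1) := by
        rw [Nat.sub_eq_iff_eq_add (Nat.one_le_pow _ _ (by omega))]
        ring
      rw [this]
      ring
    rw [this]
    exact ((even_two_mul m).pow_of_ne_zero two_ne_zero).mul_right _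
  · have h := Projectivization.card_of_finrank F (Fin 3 → F) (Module.finrank_fin_fun F)
    rw [Nat.card_eq_fintype_card, Nat.card_eq_fintype_card, hF] at h
    rw [h]
    simp only [sum_range_succ, sum_range_zero]
    ring
  · rintro ⟨U, u, w, hu, rfl⟩
    -- Applying `σ⁻¹` to `w ⬝ᵥ (σ ∘ x) = 0` makes the second equation linear in `x`.
    have h := odd_card_ne_zero_orthogonal (F := F) (hF ▸ even_two_mul m) u (σ.symm ∘ w)
    convert h using 1
    rw [← card_map (Function.Embedding.subtype _)]
    congr 1
    ext x
    simp only [mem_map, mem_filter, mem_univ, true_and, Function.Embedding.subtype_apply,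
      Subtype.exists, exists_and_right, exists_eq_right, hI]
    have hσ : (σ.symm ∘ w) ⬝ᵥ x = σ.symm (w ⬝ᵥ (σ ∘ x)) := by
      simp [dotProduct]
    rw [D.le_line_iff rfl, hσ]
    simp [TwistedIncident, and_left_comm]
  · rw [Multiset.sum_count_eq_card (fun P _ => mem_univ P), hcard]
    have : m ≤ 8 * m ^ 4 := by nlinarith [Nat.le_self_pow (n := 4) (by norm_num) m]
    push_cast [this]
    ring
  · rintro ⟨U, u, w, hu, rfl⟩
    refine le_trans (le_of_eq ?_) (hline ⟨D.line u w, D.nonempty_basis_line hu w⟩)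
    change _ = Multiset.countP (fun P => P.1 ≤ D.line u w) K
    rw [Multiset.countP_eq_card_filter,
      ← Multiset.sum_count_eq_card (s := {P : PHG.Point R | P.1 ≤ D.line u w})]
    · refine sum_congr rfl fun P hP => ?_
      rw [Multiset.count_filter_of_pos]
      exact (mem_filter.1 hP).2
    · intro P hP
      rw [mem_filter]
      exact ⟨mem_univ _, (Multiset.mem_filter.1 hP).2⟩

end TwistedDual

/-! ### From nonexistence to the maximal arc size -/

theorem PHG.IsProjectiveArc.mono {R : Type*} [Ring R] {K K' : Multiset (PHG.Point R)} {k n : ℕ}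
    (hK : PHG.IsProjectiveArc K k n) (h : K' ≤ K) : PHG.IsProjectiveArc K' K'.card n := by
  classical
  exact ⟨⟨rfl, fun L => (Multiset.countP_le_of_le _ h).trans (hK.1.2 L)⟩,
    Multiset.nodup_of_le h hK.2⟩

theorem mainTheorem5 (r q : ℕ) (hq : q = 2 ^ r) (F : Type*) [Field F] (hF : Nat.card F = q)
    (σ : F ≃+* F) :
    (¬ ∃ K : Multiset (PHG.Point (TruncSkewPoly F σ)),
        PHG.IsArc K ((q ^ 4 - q) / 2) (q ^ 2 / 2)) ∧
      ∃ m : ℕ, PHG.IsMaxArcSize (TruncSkewPoly F σ) (q ^ 2 / 2) m ∧ m < (q ^ 4 - q) / 2 := by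
  have hfin : Finite F := Nat.finite_of_card_ne_zero (by rw [hF, hq]; positivity)
  have := Fintype.ofFinite F
  have hr : r ≠ 0 := by
    rintro rfl
    have := Finite.one_lt_card (α := F)
    omega
  obtain ⟨s, rfl⟩ := Nat.exists_eq_succ_of_ne_zero hr
  obtain ⟨m, hm⟩ : ∃ m, q = 2 * m := ⟨2 ^ s, by rw [hq, Nat.succ_eq_add_one, pow_succ, mul_comm]⟩
  have hk : (q ^ 4 - q) / 2 = 8 * m ^ 4 - m := by
    have : q ^ 4 = 2 * (8 * m ^ 4) := by rw [hm]; ring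
    omega
  have hn : q ^ 2 / 2 = 2 * m ^ 2 := by
    have : q ^ 2 = 2 * (2 * m ^ 2) := by rw [hm]; ring
    omega
  have hno : ∀ K : Multiset (PHG.Point (TruncSkewPoly F σ)),
      ¬ PHG.IsArc K ((q ^ 4 - q) / 2) (q ^ 2 / 2) := by
    rw [hk, hn]
    exact (TruncSkewPoly.twistedDual σ).not_isArc (by rw [← Nat.card_eq_fintype_card, hF, hm])
  have hlt : ∀ k ∈ {k : ℕ | ∃ K : Multiset (PHG.Point (TruncSkewPoly F σ)),
      PHG.IsProjectiveArc K k (q ^ 2 / 2)}, k < (q ^ 4 - q) / 2 := by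
    rintro k ⟨K, hK⟩
    -- A projective arc that is too large contains a sub-multiset of exactly the forbidden size.
    by_contra! hle
    rw [← hK.1.1] at hle
    obtain ⟨K', hK'⟩ := Multiset.card_pos_iff_exists_mem.1
      ((Nat.choose_pos hle).trans_eq (Multiset.card_powersetCard _ K).symm)
    obtain ⟨hKK', hcard⟩ := Multiset.mem_powersetCard.1 hK'
    exact hno K' (hcard ▸ (hK.mono hKK').1)
  have hbdd : BddAbove {k : ℕ | ∃ K : Multiset (PHG.Point (TruncSkewPoly F σ)),
      PHG.IsProjectiveArc K k (q ^ 2 / 2)} := ⟨_, fun k hk => (hlt k hk).le⟩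
  have hne : {k : ℕ | ∃ K : Multiset (PHG.Point (TruncSkewPoly F σ)),
      PHG.IsProjectiveArc K k (q ^ 2 / 2)}.Nonempty :=
    ⟨0, 0, ⟨rfl, fun L => by simp [PHG.lineMult]⟩, Multiset.nodup_zero⟩
  have hmem := Nat.sSup_mem hne hbdd
  exact ⟨fun ⟨K, hK⟩ => hno K hK, _, ⟨hmem, fun k hk => le_csSup hbdd hk⟩, hlt _ hmem⟩
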